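/- Let $T>0$, let $b,\sigma:[0,T]\times\mathbb R\to\mathbb R$, $g:[0,T]\times\mathbb R^3\to\mathbb R$, $(t,x,u,z)\mapsto g(t,x,u,z)$, and $H:\mathbb R\to\mathbb R$ be smooth, and assume $\sigma(t,x)\neq0$ for all $(t,x)$. Consider the terminal value problem $$\Delta:=u_t+b(t,x)u_x+\tfrac12\sigma^2(t,x)u_{xx}+g(t,x,u,\sigma(t,x)u_x)=0,\qquad u(T,x)=H(x),$$ and a smooth vector field $v=\theta(t,x,u)\partial_t+\gamma(t,x,u)\partial_x+\phi(t,x,u)\partial_u$ on $[0,T]\times\mathbb R^2$. The *determining system* of the problem is the following system for $(\theta,\gamma,\phi)$, required for all $t\in[0,T]$ and all $x,u,u_x\in\mathbb R$, with $g$ and its partial derivatives evaluated at $(t,x,u,\sigma(t,x)u_x)$ and with $(g\theta)_t=g_t\theta+g\theta_t$: \begin{align*} &(g\theta)_t+g_x\gamma+g_u\phi+\tfrac12\sigma^2\phi_{xx}+(b+\sigma g_z)\phi_x+\phi_t-g\phi_u+\tfrac12\sigma^2g\theta_{xx}+(b+\sigma g_z)g\theta_x-g^2\theta_u=0,\\ &\tfrac12\sigma^2\gamma_{xx}+(b+\sigma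 g_z)\gamma_x+\gamma_t-g\gamma_u-(b_x+\sigma_xg_z)\gamma-\tfrac12\sigma^2b\theta_{xx}-\sigma^2g\theta_{xu}+(b-\sigma g_z)g\theta_u\\ &\qquad-(b+\sigma g_z)b\theta_x-(b\theta)_t-\sigma^2\phi_{xu}-\sigma_tg_z\theta-\sigma g_z\phi_u=0,\\ &\tfrac12\sigma^4\theta_{xx}+\tfrac12\sigma^2(b+\sigma g_z)\theta_x-\tfrac12\sigma^2g\theta_u+\tfrac12\sigma^2\theta_t+\sigma\sigma_t\theta-\sigma^2\gamma_x+\sigma\sigma_x\gamma=0,\\ &\tfrac12\sigma^2\phi_{uu}-\sigma^2\gamma_{xu}-\sigma g_z\gamma_u+\tfrac12\sigma^2g\theta_{uu}+b\sigma^2\theta_{xu}+b\sigma g_z\theta_u=0,\\ &\tfrac12\sigma^3g_z\theta_u+\tfrac12\sigma^4\theta_{xu}-\sigma^2\gamma_u=0,\\ &\tfrac12\sigma^2(-\gamma_{uu}+b\theta_{uu})=0,\qquad\sigma^2\theta_x=0,\qquad\sigma^2\theta_u=0,\\ &\phi(t,x,H(x))=H'(x)\,\gamma(t,x,H(x)).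 \end{align*} 1. The determining system is equivalent to the following reduced system (same conventions): \begin{align*} &\phi_t+\tfrac12\sigma^2\phi_{xx}+(b+\sigma g_z)\phi_x+(g\theta)_t+g_x\gamma+g_u\phi-g\phi_u=0,\\ &-\gamma_t-\tfrac12\sigma^2\gamma_{xx}-(b+\sigma g_z)\gamma_x+(b_x+\sigma_xg_z)\gamma+\sigma_tg_z\theta+(b\theta)_t+\sigma g_z\phi_u+\sigma^2\phi_{xu}=0,\\ &-\sigma\gamma_x+\sigma_x\gamma+\tfrac12\sigma\theta_t+\sigma_t\theta=0,\qquad\phi_{uu}=0,\qquad\theta_x=\theta_u=\gamma_u=0,\\ &\phi(t,x,H(x))=H'(x)\,\gamma(t,x,H(x)). \end{align*} 2. The determining system holds if and only if there are smooth $\theta(t)$, $\gamma(t,x)$, $\delta(t,x)$, $\beta(t,x)$ such that $\phi=\delta u+\beta$, $\beta=H'\gamma-\delta H$, i.e. $$v=\theta(t)\partial_t+\gamma(t,x)\partial_x+\big[\delta(t,x)u+H'(x)\gamma(t,x)-\delta(t,x)H(x)\big]\partial_u,$$ and, for all $t,x,u,u_x$, with $g$ and its derivatives evaluated as above, \begin{align*}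 &\tfrac12\sigma^2(\beta_{xx}+\delta_{xx}u)+(b+\sigma g_z)(\beta_x+\delta_xu)+(\beta_t+\delta_tu)+g_u(\beta+\delta u)-g\delta+g_x\gamma+(g\theta)_t=0,\\ &-\tfrac12\sigma^2\gamma_{xx}-\gamma_t-(b+\sigma g_z)\gamma_x+(b_x+\sigma_xg_z)\gamma+(b\theta)_t+\sigma^2\delta_x+\sigma g_z\delta+\sigma_tg_z\theta=0,\\ &-\sigma\gamma_x+\sigma_x\gamma+\tfrac12\sigma\theta_t+\sigma_t\theta=0. \end{align*} 3. Call $v$ a symmetry generator of the problem if $\mathrm{pr}^{2}v(\Delta)=0$ at all points of the second jet space with $\Delta=0$, and $\phi(t,x,H(x))=H'(x)\gamma(t,x,H(x))$ for all $t,x$. Every solution of the determining system is a symmetry generator. Every symmetry generator satisfies $\theta_x=\theta_u=\gamma_u=0$ and $-\sigma\gamma_x+\sigma_x\gamma+\tfrac12\sigma\theta_t+\sigma_t\theta=0$. If $g$ does not depend on $z$, every symmetry generator satisfies the determining system, and hence has the form in 2. -/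

import Mathlib

open Set

noncomputable section

namespace SemilinearPDE

/- Time runs through `[0, T]`, space and the dependent variable through `ℝ`. Time derivatives are taken
within `[0, T]`, so they are one-sided at the two end points. -/

/-- `f(t, x)` is smooth on `[0, T] × ℝ`. -/
def Smooth2 (T : ℝ) (f : ℝ → ℝ → ℝ) : Prop :=
  ContDiffOn ℝ ((⊤ : ℕ∞) : WithTop ℕ∞) (fun q : ℝ × ℝ => f q.1 q.2) (Icc 0 T ×ˢ univ)

/-- `f(t, x, u)` is smooth on `[0, T] × ℝ × ℝ`. -/
def Smooth3 (T : ℝ) (f : ℝ → ℝ → ℝ → ℝ) : Prop :=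
  ContDiffOn ℝ ((⊤ : ℕ∞) : WithTop ℕ∞) (fun q : ℝ × ℝ × ℝ => f q.1 q.2.1 q.2.2)
    (Icc 0 T ×ˢ univ)

/-- `f(t, x, u, z)` is smooth on `[0, T] × ℝ × ℝ × ℝ`. -/
def Smooth4 (T : ℝ) (f : ℝ → ℝ → ℝ → ℝ → ℝ) : Prop :=
  ContDiffOn ℝ ((⊤ : ℕ∞) : WithTop ℕ∞)
    (fun q : ℝ × ℝ × ℝ × ℝ => f q.1 q.2.1 q.2.2.1 q.2.2.2) (Icc 0 T ×ˢ univ)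

/-! Partial derivatives; `du (dx f)` is `f_{xu}`. -/

def dt1 (T : ℝ) (f : ℝ → ℝ) (t : ℝ) : ℝ := derivWithin f (Icc 0 T) t

def dt2 (T : ℝ) (f : ℝ → ℝ → ℝ) (t x : ℝ) : ℝ := derivWithin (fun s => f s x) (Icc 0 T) t

def dx2 (f : ℝ → ℝ → ℝ) (t x : ℝ) : ℝ := deriv (fun y => f t y) x

def dt (T : ℝ) (f : ℝ → ℝ → ℝ → ℝ) (t x u : ℝ) : ℝ :=
  derivWithin (fun s => f s x u) (Icc 0 T) t

def dx (f : ℝ → ℝ → ℝ → ℝ) (t x u : ℝ) : ℝ := deriv (fun y => f t y u) x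

def du (f : ℝ → ℝ → ℝ → ℝ) (t x u : ℝ) : ℝ := deriv (fun w => f t x w) u

def dt4 (T : ℝ) (f : ℝ → ℝ → ℝ → ℝ → ℝ) (t x u z : ℝ) : ℝ :=
  derivWithin (fun s => f s x u z) (Icc 0 T) t

def dx4 (f : ℝ → ℝ → ℝ → ℝ → ℝ) (t x u z : ℝ) : ℝ := deriv (fun y => f t y u z) x

def du4 (f : ℝ → ℝ → ℝ → ℝ → ℝ) (t x u z : ℝ) : ℝ := deriv (fun w => f t x w z) u

def dz4 (f : ℝ → ℝ → ℝ → ℝ → ℝ) (t x u z : ℝ) : ℝ := deriv (fun w => f t x u w) z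

/-- The data of the terminal value problem
`u_t + b(t,x) u_x + (1/2) σ(t,x)^2 u_xx + g(t, x, u, σ(t,x) u_x) = 0`, `u(T, x) = H(x)`. -/
structure Problem where
  T : ℝ
  T_pos : 0 < T
  b : ℝ → ℝ → ℝ
  σ : ℝ → ℝ → ℝ
  g : ℝ → ℝ → ℝ → ℝ → ℝ
  H : ℝ → ℝ
  smooth_b : Smooth2 T b
  smooth_σ : Smooth2 T σ
  smooth_g : Smooth4 T g
  smooth_H : ContDiff ℝ ((⊤ : ℕ∞) : WithTop ℕ∞) H

/-- A smooth vector field `θ(t,x,u) ∂_t + γ(t,x,u) ∂_x + φ(t,x,u) ∂_u`. -/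
structure VField (T : ℝ) where
  θ : ℝ → ℝ → ℝ → ℝ
  γ : ℝ → ℝ → ℝ → ℝ
  φ : ℝ → ℝ → ℝ → ℝ
  smooth_θ : Smooth3 T θ
  smooth_γ : Smooth3 T γ
  smooth_φ : Smooth3 T φ

namespace VField

variable {T : ℝ} (v : VField T)

/-! The coefficients of `∂/∂u_t`, `∂/∂u_x` and `∂/∂u_xx` in the second prolongation of `v`. Below
`q = u_t`, `p = u_x`, `s = u_xt`, `r = u_xx`. -/

def prT (t x u q p : ℝ) : ℝ :=
  dt T v.φ t x u - dt T v.γ t x u * p + (du v.φ t x u - dt T v.θ t x u) * q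
    - du v.γ t x u * p * q - du v.θ t x u * q ^ 2

def prX (t x u q p : ℝ) : ℝ :=
  dx v.φ t x u + (du v.φ t x u - dx v.γ t x u) * p - dx v.θ t x u * q
    - du v.γ t x u * p ^ 2 - du v.θ t x u * p * q

def prXX (t x u q p s r : ℝ) : ℝ :=
  dx (dx v.φ) t x u + (2 * du (dx v.φ) t x u - dx (dx v.γ) t x u) * p
    - dx (dx v.θ) t x u * q
    + (du (du v.φ) t x u - 2 * du (dx v.γ) t x u) * p ^ 2
    - 2 * du (dx v.θ) t x u * p * q
    - du (du v.γ) t x u * p ^ 3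
    - du (du v.θ) t x u * p ^ 2 * q
    + (du v.φ t x u - 2 * dx v.γ t x u) * r
    - 2 * dx v.θ t x u * s
    - 3 * du v.γ t x u * p * r
    - du v.θ t x u * q * r
    - 2 * du v.θ t x u * p * s

end VField

namespace Problem

variable (P : Problem)

/-- The left-hand side `Δ` of the equation, as a function on the second jet space
(it does not depend on `u_xt`, `u_tt`). -/
def Δ (t x u q p r : ℝ) : ℝ :=
  q + P.b t x * p + 1 / 2 * P.σ t x ^ 2 * r + P.g t x u (P.σ t x * p)

/-- `pr² v (Δ)`. -/
def prΔ (v : VField P.T) (t x u q p s r : ℝ) : ℝ :=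
  v.θ t x u * derivWithin (fun t' => P.Δ t' x u q p r) (Icc 0 P.T) t
    + v.γ t x u * deriv (fun x' => P.Δ t x' u q p r) x
    + v.φ t x u * deriv (fun u' => P.Δ t x u' q p r) u
    + v.prT t x u q p * deriv (fun q' => P.Δ t x u q' p r) q
    + v.prX t x u q p * deriv (fun p' => P.Δ t x u q p' r) p
    + v.prXX t x u q p s r * deriv (fun r' => P.Δ t x u q p r') r

/-- The condition on `v` that keeps the terminal condition `u = H(x)`; it is imposed at all times,
since the terminal time itself is transformed. -/
def TerminalCondition (v : VField P.T) : Prop :=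
  ∀ t ∈ Icc 0 P.T, ∀ x, v.φ t x (P.H x) = deriv P.H x * v.γ t x (P.H x)

/-- Lie's infinitesimal criterion: `pr² v (Δ) = 0` wherever `Δ = 0`, and the terminal condition. -/
def IsLieSymmetry (v : VField P.T) : Prop :=
  (∀ t ∈ Icc 0 P.T, ∀ x u q p s r, P.Δ t x u q p r = 0 → P.prΔ v t x u q p s r = 0) ∧
    P.TerminalCondition v

/-- `(gθ)_t` for `θ = θ(t, x, u)`, with `x, u, z` held fixed. -/
def gθt (θ : ℝ → ℝ → ℝ → ℝ) (t x u z : ℝ) : ℝ :=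
  dt4 P.T (fun t x u z => P.g t x u z * θ t x u) t x u z

/-- The determining system, before any simplification. The equations hold for all `t, x, u` and all
values `p` of `u_x`, and `g` and its derivatives are taken at `(t, x, u, σ(t,x) p)`. -/
structure DeterminingSystem (v : VField P.T) : Prop where
  eq1 : ∀ t ∈ Icc 0 P.T, ∀ x u p, ∀ z, z = P.σ t x * p →
    P.gθt v.θ t x u z + dx4 P.g t x u z * v.γ t x u + du4 P.g t x u z * v.φ t x u
      + 1 / 2 * P.σ t x ^ 2 * dx (dx v.φ) t x u
      + (P.b t x + P.σ t x * dz4 P.g t x u z) * dx v.φ t x u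
      + dt P.T v.φ t x u - P.g t x u z * du v.φ t x u
      + 1 / 2 * P.σ t x ^ 2 * P.g t x u z * dx (dx v.θ) t x u
      + (P.b t x + P.σ t x * dz4 P.g t x u z) * P.g t x u z * dx v.θ t x u
      - P.g t x u z ^ 2 * du v.θ t x u = 0
  eq2 : ∀ t ∈ Icc 0 P.T, ∀ x u p, ∀ z, z = P.σ t x * p →
    1 / 2 * P.σ t x ^ 2 * dx (dx v.γ) t x u
      + (P.b t x + P.σ t x * dz4 P.g t x u z) * dx v.γ t x u
      + dt P.T v.γ t x u - P.g t x u z * du v.γ t x u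
      - (dx2 P.b t x + dx2 P.σ t x * dz4 P.g t x u z) * v.γ t x u
      - 1 / 2 * P.σ t x ^ 2 * P.b t x * dx (dx v.θ) t x u
      - P.σ t x ^ 2 * P.g t x u z * du (dx v.θ) t x u
      + (P.b t x - P.σ t x * dz4 P.g t x u z) * P.g t x u z * du v.θ t x u
      - (P.b t x + P.σ t x * dz4 P.g t x u z) * P.b t x * dx v.θ t x u
      - dt P.T (fun t x u => P.b t x * v.θ t x u) t x u
      - P.σ t x ^ 2 * du (dx v.φ) t x u
      - dt2 P.T P.σ t x * dz4 P.g t x u z * v.θ t x u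
      - P.σ t x * dz4 P.g t x u z * du v.φ t x u = 0
  eq3 : ∀ t ∈ Icc 0 P.T, ∀ x u p, ∀ z, z = P.σ t x * p →
    1 / 2 * P.σ t x ^ 4 * dx (dx v.θ) t x u
      + 1 / 2 * P.σ t x ^ 2 * (P.b t x + P.σ t x * dz4 P.g t x u z) * dx v.θ t x u
      - 1 / 2 * P.σ t x ^ 2 * P.g t x u z * du v.θ t x u
      + 1 / 2 * P.σ t x ^ 2 * dt P.T v.θ t x u
      + P.σ t x * dt2 P.T P.σ t x * v.θ t x u
      - P.σ t x ^ 2 * dx v.γ t x u + P.σ t x * dx2 P.σ t x * v.γ t x u = 0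
  eq4 : ∀ t ∈ Icc 0 P.T, ∀ x u p, ∀ z, z = P.σ t x * p →
    1 / 2 * P.σ t x ^ 2 * du (du v.φ) t x u - P.σ t x ^ 2 * du (dx v.γ) t x u
      - P.σ t x * dz4 P.g t x u z * du v.γ t x u
      + 1 / 2 * P.σ t x ^ 2 * P.g t x u z * du (du v.θ) t x u
      + P.b t x * P.σ t x ^ 2 * du (dx v.θ) t x u
      + P.b t x * P.σ t x * dz4 P.g t x u z * du v.θ t x u = 0
  eq5 : ∀ t ∈ Icc 0 P.T, ∀ x u p, ∀ z, z = P.σ t x * p →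
    1 / 2 * P.σ t x ^ 3 * dz4 P.g t x u z * du v.θ t x u
      + 1 / 2 * P.σ t x ^ 4 * du (dx v.θ) t x u
      - P.σ t x ^ 2 * du v.γ t x u = 0
  eq6 : ∀ t ∈ Icc 0 P.T, ∀ x u,
    1 / 2 * P.σ t x ^ 2 * (-du (du v.γ) t x u + P.b t x * du (du v.θ) t x u) = 0
  eq7 : ∀ t ∈ Icc 0 P.T, ∀ x u, P.σ t x ^ 2 * dx v.θ t x u = 0
  eq8 : ∀ t ∈ Icc 0 P.T, ∀ x u, P.σ t x ^ 2 * du v.θ t x u = 0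
  terminal : P.TerminalCondition v

/-- The equations `θ_x = θ_u = γ_u = 0` and
`-σ γ_x + σ_x γ + (1/2) σ θ_t + σ_t θ = 0`. -/
structure ProjectableEquations (v : VField P.T) : Prop where
  θ_x : ∀ t ∈ Icc 0 P.T, ∀ x u, dx v.θ t x u = 0
  θ_u : ∀ t ∈ Icc 0 P.T, ∀ x u, du v.θ t x u = 0
  γ_u : ∀ t ∈ Icc 0 P.T, ∀ x u, du v.γ t x u = 0
  eqσ : ∀ t ∈ Icc 0 P.T, ∀ x u,
    -(P.σ t x * dx v.γ t x u) + dx2 P.σ t x * v.γ t x u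
      + 1 / 2 * P.σ t x * dt P.T v.θ t x u + dt2 P.T P.σ t x * v.θ t x u = 0

/-- The simplified determining system. -/
structure ReducedSystem (v : VField P.T) : Prop extends P.ProjectableEquations v where
  eq1 : ∀ t ∈ Icc 0 P.T, ∀ x u p, ∀ z, z = P.σ t x * p →
    dt P.T v.φ t x u + 1 / 2 * P.σ t x ^ 2 * dx (dx v.φ) t x u
      + (P.b t x + P.σ t x * dz4 P.g t x u z) * dx v.φ t x u
      + P.gθt v.θ t x u z + dx4 P.g t x u z * v.γ t x u + du4 P.g t x u z * v.φ t x u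
      - P.g t x u z * du v.φ t x u = 0
  eq2 : ∀ t ∈ Icc 0 P.T, ∀ x u p, ∀ z, z = P.σ t x * p →
    -dt P.T v.γ t x u - 1 / 2 * P.σ t x ^ 2 * dx (dx v.γ) t x u
      - (P.b t x + P.σ t x * dz4 P.g t x u z) * dx v.γ t x u
      + (dx2 P.b t x + dx2 P.σ t x * dz4 P.g t x u z) * v.γ t x u
      + dt2 P.T P.σ t x * dz4 P.g t x u z * v.θ t x u
      + dt P.T (fun t x u => P.b t x * v.θ t x u) t x u
      + P.σ t x * dz4 P.g t x u z * du v.φ t x u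
      + P.σ t x ^ 2 * du (dx v.φ) t x u = 0
  φ_uu : ∀ t ∈ Icc 0 P.T, ∀ x u, du (du v.φ) t x u = 0
  terminal : P.TerminalCondition v

/-- The final structure of the determining system, for `θ(t)`, `γ(t,x)`, `δ(t,x)`, `β(t,x)`. -/
structure FinalSystem (θ : ℝ → ℝ) (γ δ β : ℝ → ℝ → ℝ) : Prop where
  eq1 : ∀ t ∈ Icc 0 P.T, ∀ x y p, ∀ z, z = P.σ t x * p →
    1 / 2 * P.σ t x ^ 2 * (dx2 (dx2 β) t x + dx2 (dx2 δ) t x * y)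
      + (P.b t x + P.σ t x * dz4 P.g t x y z) * (dx2 β t x + dx2 δ t x * y)
      + (dt2 P.T β t x + dt2 P.T δ t x * y)
      + du4 P.g t x y z * (β t x + δ t x * y) - P.g t x y z * δ t x
      + dx4 P.g t x y z * γ t x + P.gθt (fun t _ _ => θ t) t x y z = 0
  eq2 : ∀ t ∈ Icc 0 P.T, ∀ x y p, ∀ z, z = P.σ t x * p →
    -(1 / 2 * P.σ t x ^ 2 * dx2 (dx2 γ) t x) - dt2 P.T γ t x
      - (P.b t x + P.σ t x * dz4 P.g t x y z) * dx2 γ t x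
      + (dx2 P.b t x + dx2 P.σ t x * dz4 P.g t x y z) * γ t x
      + dt2 P.T (fun t x => P.b t x * θ t) t x
      + P.σ t x ^ 2 * dx2 δ t x + P.σ t x * dz4 P.g t x y z * δ t x
      + dt2 P.T P.σ t x * dz4 P.g t x y z * θ t = 0
  eqσ : ∀ t ∈ Icc 0 P.T, ∀ x,
    -(P.σ t x * dx2 γ t x) + dx2 P.σ t x * γ t x
      + 1 / 2 * P.σ t x * dt1 P.T θ t + dt2 P.T P.σ t x * θ t = 0
  β_eq : ∀ t ∈ Icc 0 P.T, ∀ x, β t x = deriv P.H x * γ t x - δ t x * P.H x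

/-- `v = θ₀(t) ∂_t + γ₀(t,x) ∂_x + [δ(t,x) u + H'(x) γ₀(t,x) - δ(t,x) H(x)] ∂_u`. -/
structure HasForm (v : VField P.T) (θ₀ : ℝ → ℝ) (γ₀ δ : ℝ → ℝ → ℝ) : Prop where
  θ_eq : ∀ t ∈ Icc 0 P.T, ∀ x u, v.θ t x u = θ₀ t
  γ_eq : ∀ t ∈ Icc 0 P.T, ∀ x u, v.γ t x u = γ₀ t x
  φ_eq : ∀ t ∈ Icc 0 P.T, ∀ x u,
    v.φ t x u = δ t x * u + deriv P.H x * γ₀ t x - δ t x * P.H x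

end Problem

end SemilinearPDE

end

namespace SemilinearPDE

/-! ### Smooth functions on the closed time strip: slices, integration in one variable, chain rule.
-/

section Slices

variable {T t : ℝ}

/-! Solving `Δ = 0` for `u_t` turns `pr² v (Δ)` into a function in which `u_xt` and `u_xx` vary
freely. They enter polynomially and not through `g`, so Lie's criterion kills their coefficients:
`u_xt` gives `θ_x = θ_u = 0`, then `u_xx` gives `γ_u = 0` and the `σ`-equation. Since `g` sees `u_x`
through `z = σ u_x`, powers of `u_x` cannot be separated in general.

On such projectable fields, with `p = u_x`, what remains is `E₁ + E₂ p + ½ σ² φ_uu p²`, where `E₁`,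
`E₂` are the left-hand sides of the first two reduced equations (`ProjectableEquations.prΔ_eq`). So
the reduced system implies the criterion; if `g` does not depend on `z`, then `E₁`, `E₂` are free of
`p` and the converse follows by comparing coefficients.

The determining system collapses to the reduced one because `σ ≠ 0` turns `σ² θ_x = σ² θ_u = 0` into
`θ = θ(t)`, after which the other equations lose all their `θ_x`, `θ_u` and, in turn, `γ_u` terms.
Finally `φ_uu = 0` makes `φ` affine in `u`, and the terminal condition fixes its constant term. -/

lemma Smooth2.contDiff_x {f : ℝ → ℝ → ℝ} (hf : Smooth2 T f) (ht : t ∈ Icc 0 T) :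
    ContDiff ℝ ((⊤ : ℕ∞) : WithTop ℕ∞) (fun x => f t x) := by
  rw [← contDiffOn_univ]
  exact ContDiffOn.comp (g := fun q : ℝ × ℝ => f q.1 q.2) (f := fun x : ℝ => (t, x)) hf
    (by fun_prop) (fun x _ => ⟨ht, mem_univ _⟩)

lemma Smooth2.contDiffOn_t {f : ℝ → ℝ → ℝ} (hf : Smooth2 T f) (x : ℝ) :
    ContDiffOn ℝ ((⊤ : ℕ∞) : WithTop ℕ∞) (fun t => f t x) (Icc 0 T) :=
  ContDiffOn.comp (g := fun q : ℝ × ℝ => f q.1 q.2) (f := fun t : ℝ => (t, x)) hf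
    (by fun_prop) (fun _ ht => ⟨ht, mem_univ _⟩)

lemma Smooth2.differentiableWithinAt_t {f : ℝ → ℝ → ℝ} (hf : Smooth2 T f) (ht : t ∈ Icc 0 T)
    (x : ℝ) : DifferentiableWithinAt ℝ (fun t => f t x) (Icc 0 T) t :=
  (hf.contDiffOn_t x).differentiableOn (by simp) t ht

lemma Smooth2.differentiable_x {f : ℝ → ℝ → ℝ} (hf : Smooth2 T f) (ht : t ∈ Icc 0 T) :
    Differentiable ℝ (fun x => f t x) :=
  (hf.contDiff_x ht).differentiable (by simp)

lemma Smooth2.differentiable_dx2 {f : ℝ → ℝ → ℝ} (hf : Smooth2 T f) (ht : t ∈ Icc 0 T) :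
    Differentiable ℝ (fun x => dx2 f t x) :=
  ((contDiff_infty_iff_deriv.1 (hf.contDiff_x ht)).2).differentiable (by simp)

lemma Smooth3.slice_u {f : ℝ → ℝ → ℝ → ℝ} (hf : Smooth3 T f) (u : ℝ) :
    Smooth2 T (fun t x => f t x u) :=
  ContDiffOn.comp (g := fun q : ℝ × ℝ × ℝ => f q.1 q.2.1 q.2.2)
    (f := fun q : ℝ × ℝ => (q.1, q.2, u)) hf (by fun_prop) (fun _ hq => ⟨hq.1, mem_univ _⟩)

lemma Smooth3.contDiff_u {f : ℝ → ℝ → ℝ → ℝ} (hf : Smooth3 T f) (ht : t ∈ Icc 0 T) (x : ℝ) :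
    ContDiff ℝ ((⊤ : ℕ∞) : WithTop ℕ∞) (fun u => f t x u) := by
  rw [← contDiffOn_univ]
  exact ContDiffOn.comp (g := fun q : ℝ × ℝ × ℝ => f q.1 q.2.1 q.2.2)
    (f := fun u : ℝ => (t, x, u)) hf (by fun_prop) (fun x _ => ⟨ht, mem_univ _⟩)

lemma Smooth3.eq_of_du_eq_zero {f : ℝ → ℝ → ℝ → ℝ} (hf : Smooth3 T f) (ht : t ∈ Icc 0 T) {x : ℝ}
    (h : ∀ u, du f t x u = 0) (u : ℝ) : f t x u = f t x 0 :=
  is_const_of_deriv_eq_zero ((hf.contDiff_u ht x).differentiable (by simp)) h u 0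

lemma Smooth3.eq_of_dx_eq_zero {f : ℝ → ℝ → ℝ → ℝ} (hf : Smooth3 T f) (ht : t ∈ Icc 0 T) {u : ℝ}
    (h : ∀ x, dx f t x u = 0) (x : ℝ) : f t x u = f t 0 u :=
  is_const_of_deriv_eq_zero ((hf.slice_u u).differentiable_x ht) h x 0

/-- The slope is written as a difference of two values of `f`, not as `f_u`, so that its smoothness
in `(t, x)` is immediate. -/
lemma Smooth3.eq_affine_of_du_du_eq_zero {f : ℝ → ℝ → ℝ → ℝ} (hf : Smooth3 T f)
    (ht : t ∈ Icc 0 T) {x : ℝ} (h : ∀ u, du (du f) t x u = 0) (u : ℝ) :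
    f t x u = (f t x 1 - f t x 0) * u + f t x 0 := by
  have hd := contDiff_infty_iff_deriv.1 (hf.contDiff_u ht x)
  have hc : ∀ w, deriv (fun u => f t x u) w = deriv (fun u => f t x u) 0 := fun w =>
    is_const_of_deriv_eq_zero (hd.2.differentiable (by simp)) h w 0
  have key : ∀ w, f t x w - deriv (fun u => f t x u) 0 * w = f t x 0 := by
    intro w
    have := is_const_of_deriv_eq_zero
      (f := fun w => f t x w - deriv (fun u => f t x u) 0 * w) (by have := hd.1; fun_prop)
      (fun w => by
        have h1 := (hd.1 w).hasDerivAt.sub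
          ((hasDerivAt_id w).const_mul (deriv (fun u => f t x u) 0))
        rw [hc w, mul_one, sub_self] at h1
        exact h1.deriv) w 0
    simpa using this
  -- `key 1` identifies the slope `f_u(t, x, 0)` with `f t x 1 - f t x 0`.
  linear_combination key u - u * key 1

/-- The chain rule for `g(t, x, u, z)` along a curve that stays in `[0, T] × ℝ³`. -/
lemma Smooth4.hasDerivWithinAt_comp {g : ℝ → ℝ → ℝ → ℝ → ℝ} (hg : Smooth4 T g) (hT : 0 < T)
    {s : Set ℝ} {τ ξ η ζ : ℝ → ℝ} {τ' ξ' η' ζ' r : ℝ} (hr : τ r ∈ Icc 0 T)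
    (hs : MapsTo τ s (Icc 0 T)) (hτ : HasDerivWithinAt τ τ' s r) (hξ : HasDerivWithinAt ξ ξ' s r)
    (hη : HasDerivWithinAt η η' s r) (hζ : HasDerivWithinAt ζ ζ' s r) :
    HasDerivWithinAt (fun r => g (τ r) (ξ r) (η r) (ζ r))
      (τ' * dt4 T g (τ r) (ξ r) (η r) (ζ r) + ξ' * dx4 g (τ r) (ξ r) (η r) (ζ r)
        + η' * du4 g (τ r) (ξ r) (η r) (ζ r) + ζ' * dz4 g (τ r) (ξ r) (η r) (ζ r)) s r := by
  have hL := (hg.differentiableOn (by simp) (τ r, ξ r, η r, ζ r)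
    (mk_mem_prod hr (mem_univ _))).hasFDerivWithinAt
  set L := fderivWithin ℝ (fun q : ℝ × ℝ × ℝ × ℝ => g q.1 q.2.1 q.2.2.1 q.2.2.2)
    (Icc 0 T ×ˢ univ) (τ r, ξ r, η r, ζ r)
  -- Each partial derivative is the total derivative `L` on a basis vector. Only the curve in `t`
  -- can leave the strip, so only it needs a one-sided derivative.
  have h1 : dt4 T g (τ r) (ξ r) (η r) (ζ r) = L (1, 0, 0, 0) := by
    have hc : HasDerivWithinAt (fun a : ℝ => (a, ξ r, η r, ζ r)) (1, 0, 0, 0) (Icc 0 T) (τ r) :=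
      (hasDerivWithinAt_id _ _).prodMk (hasDerivWithinAt_const _ _ _)
    exact (hL.comp_hasDerivWithinAt (τ r) hc (fun _ ha => mk_mem_prod ha (mem_univ _))).derivWithin
      (uniqueDiffOn_Icc hT _ hr)
  have h2 : dx4 g (τ r) (ξ r) (η r) (ζ r) = L (0, 1, 0, 0) := by
    have hc : HasDerivAt (fun a : ℝ => (τ r, a, η r, ζ r)) (0, 1, 0, 0) (ξ r) :=
      (hasDerivAt_const _ _).prodMk ((hasDerivAt_id _).prodMk (hasDerivAt_const _ _))
    exact (hL.comp_hasDerivAt (ξ r) hc (.of_forall fun _ => mk_mem_prod hr (mem_univ _))).deriv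
  have h3 : du4 g (τ r) (ξ r) (η r) (ζ r) = L (0, 0, 1, 0) := by
    have hc : HasDerivAt (fun a : ℝ => (τ r, ξ r, a, ζ r)) (0, 0, 1, 0) (η r) :=
      (hasDerivAt_const _ _).prodMk ((hasDerivAt_const _ _).prodMk
        ((hasDerivAt_id _).prodMk (hasDerivAt_const _ _)))
    exact (hL.comp_hasDerivAt (η r) hc (.of_forall fun _ => mk_mem_prod hr (mem_univ _))).deriv
  have h4 : dz4 g (τ r) (ξ r) (η r) (ζ r) = L (0, 0, 0, 1) := by
    have hc : HasDerivAt (fun a : ℝ => (τ r, ξ r, η r, a)) (0, 0, 0, 1) (ζ r) :=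
      (hasDerivAt_const _ _).prodMk ((hasDerivAt_const _ _).prodMk
        ((hasDerivAt_const _ _).prodMk (hasDerivAt_id _)))
    exact (hL.comp_hasDerivAt (ζ r) hc (.of_forall fun _ => mk_mem_prod hr (mem_univ _))).deriv
  have h5 := hL.comp_hasDerivWithinAt r (hτ.prodMk (hξ.prodMk (hη.prodMk hζ)))
    (fun _ ha => mk_mem_prod (hs ha) (mem_univ _))
  have h6 : ((τ', ξ', η', ζ') : ℝ × ℝ × ℝ × ℝ) = τ' • (1, 0, 0, 0) + ξ' • (0, 1, 0, 0)
      + η' • (0, 0, 1, 0) + ζ' • (0, 0, 0, 1) := by simp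
  have h7 : L (τ', ξ', η', ζ') = τ' * L (1, 0, 0, 0) + ξ' * L (0, 1, 0, 0)
      + η' * L (0, 0, 1, 0) + ζ' * L (0, 0, 0, 1) := by
    rw [h6]; simp only [map_add, map_smul, smul_eq_mul]
  rw [h1, h2, h3, h4, ← h7]
  exact h5

end Slices

/-! ### Derivatives of the coefficients and the expansion of `pr² v (Δ)`. -/

namespace Problem

variable (P : Problem) {t : ℝ}

lemma uniqueDiffWithinAt (ht : t ∈ Icc 0 P.T) : UniqueDiffWithinAt ℝ (Icc 0 P.T) t :=
  uniqueDiffOn_Icc P.T_pos t ht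

lemma hasDerivWithinAt_σ_t (ht : t ∈ Icc 0 P.T) (x : ℝ) :
    HasDerivWithinAt (fun s => P.σ s x) (dt2 P.T P.σ t x) (Icc 0 P.T) t :=
  (P.smooth_σ.differentiableWithinAt_t ht x).hasDerivWithinAt

lemma hasDerivWithinAt_b_t (ht : t ∈ Icc 0 P.T) (x : ℝ) :
    HasDerivWithinAt (fun s => P.b s x) (dt2 P.T P.b t x) (Icc 0 P.T) t :=
  (P.smooth_b.differentiableWithinAt_t ht x).hasDerivWithinAt

lemma hasDerivAt_σ_x (ht : t ∈ Icc 0 P.T) (x : ℝ) :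
    HasDerivAt (fun y => P.σ t y) (dx2 P.σ t x) x :=
  (P.smooth_σ.differentiable_x ht x).hasDerivAt

lemma hasDerivAt_b_x (ht : t ∈ Icc 0 P.T) (x : ℝ) :
    HasDerivAt (fun y => P.b t y) (dx2 P.b t x) x :=
  (P.smooth_b.differentiable_x ht x).hasDerivAt

lemma gθt_eq {θ : ℝ → ℝ → ℝ → ℝ} (hθ : Smooth3 P.T θ) (ht : t ∈ Icc 0 P.T) (x u z : ℝ) :
    P.gθt θ t x u z = dt4 P.T P.g t x u z * θ t x u + P.g t x u z * dt P.T θ t x u := by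
  have h1 := P.smooth_g.hasDerivWithinAt_comp P.T_pos (τ := id) (s := Icc 0 P.T) ht
    (mapsTo_id _) (hasDerivWithinAt_id t _) (hasDerivWithinAt_const t _ x)
    (hasDerivWithinAt_const t _ u) (hasDerivWithinAt_const t _ z)
  have h2 := ((hθ.slice_u u).differentiableWithinAt_t ht x).hasDerivWithinAt
  have h3 := (h1.mul h2).derivWithin (P.uniqueDiffWithinAt ht)
  refine h3.trans ?_
  simp [dt]

lemma dt_b_mul_eq {θ : ℝ → ℝ → ℝ → ℝ} (hθ : Smooth3 P.T θ) (ht : t ∈ Icc 0 P.T) (x u : ℝ) :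
    dt P.T (fun t x u => P.b t x * θ t x u) t x u
      = dt2 P.T P.b t x * θ t x u + P.b t x * dt P.T θ t x u :=
  ((P.hasDerivWithinAt_b_t ht x).mul
    ((hθ.slice_u u).differentiableWithinAt_t ht x).hasDerivWithinAt).derivWithin
      (P.uniqueDiffWithinAt ht)

/-- `pr² v (Δ)` with the partial derivatives of `Δ` carried out. -/
lemma prΔ_eq (v : VField P.T) (ht : t ∈ Icc 0 P.T) (x u q p s r z : ℝ) (hz : z = P.σ t x * p) :
    P.prΔ v t x u q p s r =
      v.θ t x u * (dt2 P.T P.b t x * p + P.σ t x * dt2 P.T P.σ t x * r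
          + dt4 P.T P.g t x u z + dt2 P.T P.σ t x * p * dz4 P.g t x u z)
        + v.γ t x u * (dx2 P.b t x * p + P.σ t x * dx2 P.σ t x * r
          + dx4 P.g t x u z + dx2 P.σ t x * p * dz4 P.g t x u z)
        + v.φ t x u * du4 P.g t x u z
        + v.prT t x u q p
        + v.prX t x u q p * (P.b t x + P.σ t x * dz4 P.g t x u z)
        + v.prXX t x u q p s r * (1 / 2 * P.σ t x ^ 2) := by
  subst hz
  have ht' : derivWithin (fun t' => P.Δ t' x u q p r) (Icc 0 P.T) t =
      dt2 P.T P.b t x * p + P.σ t x * dt2 P.T P.σ t x * r + dt4 P.T P.g t x u (P.σ t x * p)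
        + dt2 P.T P.σ t x * p * dz4 P.g t x u (P.σ t x * p) := by
    have hσ := P.hasDerivWithinAt_σ_t ht x
    -- The last slot `σ(t, x) p` moves with `t` as well, which produces the term `σ_t p g_z`.
    have hg := P.smooth_g.hasDerivWithinAt_comp P.T_pos (τ := id) (s := Icc 0 P.T) ht
      (mapsTo_id _) (hasDerivWithinAt_id t _) (hasDerivWithinAt_const t _ x)
      (hasDerivWithinAt_const t _ u) (hσ.mul_const p)
    refine ((((((P.hasDerivWithinAt_b_t ht x).mul_const p).const_add q).add
      (((hσ.pow 2).const_mul (1 / 2)).mul_const r)).add hg).derivWithin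
        (P.uniqueDiffWithinAt ht)).trans ?_
    simp only [id]
    ring
  have hx' : deriv (fun x' => P.Δ t x' u q p r) x =
      dx2 P.b t x * p + P.σ t x * dx2 P.σ t x * r + dx4 P.g t x u (P.σ t x * p)
        + dx2 P.σ t x * p * dz4 P.g t x u (P.σ t x * p) := by
    have hσ := P.hasDerivAt_σ_x ht x
    have hg := P.smooth_g.hasDerivWithinAt_comp P.T_pos (ξ := id) (s := univ) ht
      (fun _ _ => ht) (hasDerivWithinAt_const x _ t) (hasDerivWithinAt_id x _)
      (hasDerivWithinAt_const x _ u) (hσ.mul_const p).hasDerivWithinAt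
    rw [hasDerivWithinAt_univ] at hg
    refine ((((((P.hasDerivAt_b_x ht x).mul_const p).const_add q).add
      (((hσ.pow 2).const_mul (1 / 2)).mul_const r)).add hg).deriv).trans ?_
    simp only [id]
    ring
  have hu' : deriv (fun u' => P.Δ t x u' q p r) u = du4 P.g t x u (P.σ t x * p) := by
    simp [Δ, du4]
  have hq' : deriv (fun q' => P.Δ t x u q' p r) q = 1 := by
    simp [Δ]
  have hp' : deriv (fun p' => P.Δ t x u q p' r) p =
      P.b t x + P.σ t x * dz4 P.g t x u (P.σ t x * p) := by
    have hg := P.smooth_g.hasDerivWithinAt_comp P.T_pos (s := univ) ht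
      (fun _ _ => ht) (hasDerivWithinAt_const p _ t) (hasDerivWithinAt_const p _ x)
      (hasDerivWithinAt_const p _ u) ((hasDerivAt_id p).const_mul (P.σ t x)).hasDerivWithinAt
    rw [hasDerivWithinAt_univ] at hg
    refine (((((hasDerivAt_id p).const_mul (P.b t x)).const_add q).add_const
      (1 / 2 * P.σ t x ^ 2 * r)).add hg).deriv.trans ?_
    simp only [id]
    ring
  have hr' : deriv (fun r' => P.Δ t x u q p r') r = 1 / 2 * P.σ t x ^ 2 := by
    simp [Δ]
  rw [prΔ, ht', hx', hu', hq', hp', hr']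
  ring

variable {P} {v : VField P.T}

section SecondDerivatives

lemma dx_dx_eq_zero {f : ℝ → ℝ → ℝ → ℝ} (h : ∀ x u, dx f t x u = 0) (x u : ℝ) :
    dx (dx f) t x u = 0 := by
  rw [dx, funext fun y => h y u, deriv_const]

lemma du_dx_eq_zero {f : ℝ → ℝ → ℝ → ℝ} (h : ∀ x u, dx f t x u = 0) (x u : ℝ) :
    du (dx f) t x u = 0 := by
  rw [du, funext fun w => h x w, deriv_const]

lemma du_du_eq_zero {f : ℝ → ℝ → ℝ → ℝ} (h : ∀ x u, du f t x u = 0) (x u : ℝ) :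
    du (du f) t x u = 0 := by
  rw [du, funext fun w => h x w, deriv_const]

/-- No symmetry of mixed derivatives is needed: the functions `y ↦ f t y w` coincide for all `w`,
hence so do their derivatives. -/
lemma du_dx_eq_zero_of_du_eq_zero {T : ℝ} {f : ℝ → ℝ → ℝ → ℝ} (hf : Smooth3 T f)
    (ht : t ∈ Icc 0 T) (h : ∀ x u, du f t x u = 0) (x u : ℝ) : du (dx f) t x u = 0 := by
  have : ∀ w, dx f t x w = dx f t x 0 := fun w => by
    rw [dx, dx, funext fun y => hf.eq_of_du_eq_zero ht (h y) w]
  rw [du, funext this, deriv_const]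

end SecondDerivatives

/-- On projectable fields, `pr² v (Δ)` at `Δ = 0` is the sum of a term free of `u_xx` and
a multiple of the `σ`-equation. -/
lemma ProjectableEquations.prΔ_eq (h : P.ProjectableEquations v) (ht : t ∈ Icc 0 P.T)
    (x u q p s r z : ℝ) (hz : z = P.σ t x * p) (hΔ : P.Δ t x u q p r = 0) :
    P.prΔ v t x u q p s r =
      (dt P.T v.φ t x u + 1 / 2 * P.σ t x ^ 2 * dx (dx v.φ) t x u
        + (P.b t x + P.σ t x * dz4 P.g t x u z) * dx v.φ t x u
        + P.gθt v.θ t x u z + dx4 P.g t x u z * v.γ t x u + du4 P.g t x u z * v.φ t x u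
        - P.g t x u z * du v.φ t x u)
      + (-dt P.T v.γ t x u - 1 / 2 * P.σ t x ^ 2 * dx (dx v.γ) t x u
        - (P.b t x + P.σ t x * dz4 P.g t x u z) * dx v.γ t x u
        + (dx2 P.b t x + dx2 P.σ t x * dz4 P.g t x u z) * v.γ t x u
        + dt2 P.T P.σ t x * dz4 P.g t x u z * v.θ t x u
        + dt P.T (fun t x u => P.b t x * v.θ t x u) t x u
        + P.σ t x * dz4 P.g t x u z * du v.φ t x u
        + P.σ t x ^ 2 * du (dx v.φ) t x u) * p
      + 1 / 2 * P.σ t x ^ 2 * du (du v.φ) t x u * p ^ 2 := by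
  have hq : q = -(P.b t x * p + 1 / 2 * P.σ t x ^ 2 * r + P.g t x u z) := by
    rw [Δ, ← hz] at hΔ
    linear_combination hΔ
  have hθx := h.θ_x t ht
  have hθu := h.θ_u t ht
  have hγu := h.γ_u t ht
  rw [P.prΔ_eq v ht x u q p s r z hz, P.gθt_eq v.smooth_θ ht, P.dt_b_mul_eq v.smooth_θ ht,
    VField.prT, VField.prX, VField.prXX, dx_dx_eq_zero hθx, du_dx_eq_zero hθx, du_du_eq_zero hθu,
    du_du_eq_zero hγu, du_dx_eq_zero_of_du_eq_zero v.smooth_γ ht hγu, hθx, hθu, hγu, hq]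
  -- After elimination of `u_t` the two `φ_u r` contributions cancel, and the coefficient of `r` is
  -- `σ` times the `σ`-equation.
  linear_combination P.σ t x * r * h.eqσ t ht x u

/-! ### Lie's criterion compared with the reduced system. -/

theorem IsLieSymmetry.projectableEquations (hσ : ∀ t ∈ Icc 0 P.T, ∀ x, P.σ t x ≠ 0)
    (h : P.IsLieSymmetry v) : P.ProjectableEquations v := by
  have key : ∀ t ∈ Icc 0 P.T, ∀ x u p s r, P.prΔ v t x u
      (-(P.b t x * p + 1 / 2 * P.σ t x ^ 2 * r + P.g t x u (P.σ t x * p))) p s r = 0 :=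
    fun t ht x u p s r => h.1 t ht x u _ p s r (by rw [Δ]; ring)
  have hs : ∀ t ∈ Icc 0 P.T, ∀ x u p, dx v.θ t x u + du v.θ t x u * p = 0 := by
    intro t ht x u p
    -- The coefficient of `s = u_xt` is `-σ² (θ_x + θ_u p)`; the difference between `s = 0` and `s =
    -- 1` isolates it.
    have h0 := key t ht x u p 0 0
    have h1 := key t ht x u p 1 0
    rw [P.prΔ_eq v ht _ _ _ _ _ _ _ rfl, VField.prXX] at h0 h1
    apply (mul_eq_zero.1 _).resolve_left (pow_ne_zero 2 (hσ t ht x))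
    linear_combination h0 - h1
  have hθx : ∀ t ∈ Icc 0 P.T, ∀ x u, dx v.θ t x u = 0 := fun t ht x u => by
    linear_combination hs t ht x u 0
  have hθu : ∀ t ∈ Icc 0 P.T, ∀ x u, du v.θ t x u = 0 := fun t ht x u => by
    linear_combination hs t ht x u 1 - hs t ht x u 0
  have hr : ∀ t ∈ Icc 0 P.T, ∀ x u p,
      -(P.σ t x * dx v.γ t x u) + dx2 P.σ t x * v.γ t x u
      + 1 / 2 * P.σ t x * dt P.T v.θ t x u + dt2 P.T P.σ t x * v.θ t x u
      - P.σ t x * du v.γ t x u * p = 0 := by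
    intro t ht x u p
    -- With `θ_x = θ_u = 0` the expression is affine in `r = u_xx`. The `γ_u` terms of `prT`
    -- (through `u_t`) and `prXX` add up to `½ - 3/2 = -1` times `σ² γ_u p r`.
    have h0 := key t ht x u p 0 0
    have h1 := key t ht x u p 0 1
    rw [P.prΔ_eq v ht _ _ _ _ _ _ _ rfl, VField.prT, VField.prX, VField.prXX,
      dx_dx_eq_zero (hθx t ht), du_dx_eq_zero (hθx t ht), du_du_eq_zero (hθu t ht),
      hθx t ht, hθu t ht] at h0 h1
    apply (mul_eq_zero.1 _).resolve_left (hσ t ht x)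
    linear_combination h1 - h0
  refine ⟨hθx, hθu, fun t ht x u => ?_, fun t ht x u => ?_⟩
  · apply (mul_eq_zero.1 _).resolve_left (hσ t ht x)
    linear_combination hr t ht x u 0 - hr t ht x u 1
  · linear_combination hr t ht x u 0

theorem ReducedSystem.isLieSymmetry (h : P.ReducedSystem v) : P.IsLieSymmetry v := by
  refine ⟨fun t ht x u q p s r hΔ => ?_, h.terminal⟩
  rw [h.toProjectableEquations.prΔ_eq ht x u q p s r _ rfl hΔ]
  linear_combination h.eq1 t ht x u p _ rfl + p * h.eq2 t ht x u p _ rfl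
    + 1 / 2 * P.σ t x ^ 2 * p ^ 2 * h.φ_uu t ht x u

/-- Without `z` in `g`, the criterion is a polynomial identity of degree two in `p`, so three values
of `p` separate its coefficients. -/
theorem IsLieSymmetry.reducedSystem (hσ : ∀ t ∈ Icc 0 P.T, ∀ x, P.σ t x ≠ 0)
    (hg : ∀ t ∈ Icc 0 P.T, ∀ x y z z', P.g t x y z = P.g t x y z') (h : P.IsLieSymmetry v) :
    P.ReducedSystem v := by
  have hp := h.projectableEquations hσ
  have hgz : ∀ t ∈ Icc 0 P.T, ∀ x u z, dz4 P.g t x u z = 0 := fun t ht x u z => by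
    rw [dz4, funext fun w => hg t ht x u w 0, deriv_const]
  have hgx : ∀ t ∈ Icc 0 P.T, ∀ x u z, dx4 P.g t x u z = dx4 P.g t x u 0 :=
    fun t ht x u z => by rw [dx4, funext fun y => hg t ht y u z 0, dx4]
  have hgu : ∀ t ∈ Icc 0 P.T, ∀ x u z, du4 P.g t x u z = du4 P.g t x u 0 :=
    fun t ht x u z => by rw [du4, funext fun w => hg t ht x w z 0, du4]
  have hgt : ∀ t ∈ Icc 0 P.T, ∀ x u z, P.gθt v.θ t x u z = P.gθt v.θ t x u 0 :=
    fun t ht x u z => derivWithin_congr (fun s hs => by simp only [hg s hs x u z 0])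
      (by simp only [hg t ht x u z 0])
  have key : ∀ t ∈ Icc 0 P.T, ∀ x u p,
      (dt P.T v.φ t x u + 1 / 2 * P.σ t x ^ 2 * dx (dx v.φ) t x u
        + P.b t x * dx v.φ t x u
        + P.gθt v.θ t x u 0 + dx4 P.g t x u 0 * v.γ t x u + du4 P.g t x u 0 * v.φ t x u
        - P.g t x u 0 * du v.φ t x u)
      + (-dt P.T v.γ t x u - 1 / 2 * P.σ t x ^ 2 * dx (dx v.γ) t x u
        - P.b t x * dx v.γ t x u + dx2 P.b t x * v.γ t x u
        + dt P.T (fun t x u => P.b t x * v.θ t x u) t x u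
        + P.σ t x ^ 2 * du (dx v.φ) t x u) * p
      + 1 / 2 * P.σ t x ^ 2 * du (du v.φ) t x u * p ^ 2 = 0 := by
    intro t ht x u p
    -- Any jet over `(t, x, u, p)` with `Δ = 0` would do; the simplest has `u_xx = u_xt = 0`.
    have hΔ : P.Δ t x u (-(P.b t x * p + P.g t x u (P.σ t x * p))) p 0 = 0 := by rw [Δ]; ring
    have h0 := h.1 t ht x u _ p 0 0 hΔ
    rw [hp.prΔ_eq ht x u _ p 0 0 _ rfl hΔ, hgz t ht, hgx t ht, hgu t ht, hgt t ht,
      hg t ht x u _ 0] at h0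
    linear_combination h0
  refine ⟨hp, fun t ht x u p z _ => ?_, fun t ht x u p z _ => ?_, fun t ht x u => ?_, h.2⟩
  · rw [hgz t ht, hgx t ht, hgu t ht, hgt t ht, hg t ht x u _ 0]
    -- The constant, odd and even parts in `p` are read off from `p = 0, 1, -1`.
    linear_combination key t ht x u 0
  · rw [hgz t ht]
    linear_combination 1 / 2 * key t ht x u 1 - 1 / 2 * key t ht x u (-1)
  · apply (mul_eq_zero.1 _).resolve_left (pow_ne_zero 2 (hσ t ht x))
    linear_combination key t ht x u 1 + key t ht x u (-1) - 2 * key t ht x u 0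

/-! ### Determining, reduced and final systems. -/

theorem determiningSystem_iff_reducedSystem (hσ : ∀ t ∈ Icc 0 P.T, ∀ x, P.σ t x ≠ 0) :
    P.DeterminingSystem v ↔ P.ReducedSystem v := by
  constructor
  · intro h
    have hθx : ∀ t ∈ Icc 0 P.T, ∀ x u, dx v.θ t x u = 0 := fun t ht x u =>
      (mul_eq_zero.1 (h.eq7 t ht x u)).resolve_left (pow_ne_zero 2 (hσ t ht x))
    have hθu : ∀ t ∈ Icc 0 P.T, ∀ x u, du v.θ t x u = 0 := fun t ht x u =>
      (mul_eq_zero.1 (h.eq8 t ht x u)).resolve_left (pow_ne_zero 2 (hσ t ht x))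
    have hγu : ∀ t ∈ Icc 0 P.T, ∀ x u, du v.γ t x u = 0 := fun t ht x u => by
      -- Once `θ_u` and `θ_xu` vanish, only `-σ² γ_u` is left, for every `p`; `p = 0` is an
      -- arbitrary choice.
      have := h.eq5 t ht x u 0 _ rfl
      rw [hθu t ht, du_dx_eq_zero (hθx t ht)] at this
      apply (mul_eq_zero.1 _).resolve_left (pow_ne_zero 2 (hσ t ht x))
      linear_combination -this
    refine ⟨⟨hθx, hθu, hγu, fun t ht x u => ?_⟩, fun t ht x u p z hz => ?_,
      fun t ht x u p z hz => ?_, fun t ht x u => ?_, h.terminal⟩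
    · have := h.eq3 t ht x u 0 _ rfl
      rw [dx_dx_eq_zero (hθx t ht), hθx t ht, hθu t ht] at this
      apply (mul_eq_zero.1 _).resolve_left (hσ t ht x)
      linear_combination this
    · have := h.eq1 t ht x u p z hz
      rw [dx_dx_eq_zero (hθx t ht), hθx t ht, hθu t ht] at this
      linear_combination this
    · have := h.eq2 t ht x u p z hz
      rw [dx_dx_eq_zero (hθx t ht), du_dx_eq_zero (hθx t ht), hθx t ht, hθu t ht,
        hγu t ht] at this
      linear_combination -this
    · have := h.eq4 t ht x u 0 _ rfl
      rw [du_dx_eq_zero (hθx t ht), du_dx_eq_zero_of_du_eq_zero v.smooth_γ ht (hγu t ht),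
        du_du_eq_zero (hθu t ht), hθu t ht, hγu t ht] at this
      apply (mul_eq_zero.1 _).resolve_left (pow_ne_zero 2 (hσ t ht x))
      linear_combination 2 * this
  · intro h
    have hθx := h.θ_x
    have hθu := h.θ_u
    have hγu := h.γ_u
    refine ⟨fun t ht x u p z hz => ?_, fun t ht x u p z hz => ?_, fun t ht x u p z hz => ?_,
      fun t ht x u p z hz => ?_, fun t ht x u p z hz => ?_, fun t ht x u => ?_,
      fun t ht x u => ?_, fun t ht x u => ?_, h.terminal⟩
    · rw [dx_dx_eq_zero (hθx t ht), hθx t ht, hθu t ht]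
      linear_combination h.eq1 t ht x u p z hz
    · rw [dx_dx_eq_zero (hθx t ht), du_dx_eq_zero (hθx t ht), hθx t ht, hθu t ht, hγu t ht]
      linear_combination -h.eq2 t ht x u p z hz
    · rw [dx_dx_eq_zero (hθx t ht), hθx t ht, hθu t ht]
      linear_combination P.σ t x * h.eqσ t ht x u
    · rw [du_dx_eq_zero (hθx t ht), du_dx_eq_zero_of_du_eq_zero v.smooth_γ ht (hγu t ht),
        du_du_eq_zero (hθu t ht), hθu t ht, hγu t ht, h.φ_uu t ht]
      ring
    · rw [du_dx_eq_zero (hθx t ht), hθu t ht, hγu t ht]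
      ring
    · rw [du_du_eq_zero (hθu t ht), du_du_eq_zero (hγu t ht)]
      ring
    · rw [hθx t ht, mul_zero]
    · rw [hθu t ht, mul_zero]

/-- For a field `θ₀(t) ∂_t + γ₀(t,x) ∂_x + (δ(t,x) u + β(t,x)) ∂_u`, the reduced system is the
final system. -/
theorem reducedSystem_iff_finalSystem {θ₀ : ℝ → ℝ} {γ₀ δ β : ℝ → ℝ → ℝ} (hδ : Smooth2 P.T δ)
    (hβ : Smooth2 P.T β) (hθ : ∀ t ∈ Icc 0 P.T, ∀ x u, v.θ t x u = θ₀ t)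
    (hγ : ∀ t ∈ Icc 0 P.T, ∀ x u, v.γ t x u = γ₀ t x)
    (hφ : ∀ t ∈ Icc 0 P.T, ∀ x u, v.φ t x u = δ t x * u + β t x) :
    P.ReducedSystem v ↔ P.FinalSystem θ₀ γ₀ δ β := by
  -- The given form of `v` holds on `[0, T]` only, which is enough because time derivatives are
  -- taken within that interval.
  have hθt : ∀ t ∈ Icc 0 P.T, ∀ x u, dt P.T v.θ t x u = dt1 P.T θ₀ t := fun t ht x u =>
    derivWithin_congr (fun s hs => hθ s hs x u) (hθ t ht x u)
  have hgθ : ∀ t ∈ Icc 0 P.T, ∀ x u z,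
      P.gθt v.θ t x u z = P.gθt (fun t _ _ => θ₀ t) t x u z := fun t ht x u z =>
    derivWithin_congr (fun s hs => by simp only [hθ s hs x u]) (by simp only [hθ t ht x u])
  have hbθ : ∀ t ∈ Icc 0 P.T, ∀ x u, dt P.T (fun t x u => P.b t x * v.θ t x u) t x u
      = dt2 P.T (fun t x => P.b t x * θ₀ t) t x := fun t ht x u =>
    derivWithin_congr (fun s hs => by simp only [hθ s hs x u]) (by simp only [hθ t ht x u])
  have hθx : ∀ t ∈ Icc 0 P.T, ∀ x u, dx v.θ t x u = 0 := fun t ht x u => by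
    rw [dx, funext fun y => hθ t ht y u, deriv_const]
  have hθu : ∀ t ∈ Icc 0 P.T, ∀ x u, du v.θ t x u = 0 := fun t ht x u => by
    rw [du, funext fun w => hθ t ht x w, deriv_const]
  have hγt : ∀ t ∈ Icc 0 P.T, ∀ x u, dt P.T v.γ t x u = dt2 P.T γ₀ t x := fun t ht x u =>
    derivWithin_congr (fun s hs => hγ s hs x u) (hγ t ht x u)
  have hγx : ∀ t ∈ Icc 0 P.T, ∀ x u, dx v.γ t x u = dx2 γ₀ t x := fun t ht x u => by
    rw [dx, funext fun y => hγ t ht y u, dx2]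
  have hγxx : ∀ t ∈ Icc 0 P.T, ∀ x u, dx (dx v.γ) t x u = dx2 (dx2 γ₀) t x :=
    fun t ht x u => by rw [dx, funext fun y => hγx t ht y u, dx2]
  have hγu : ∀ t ∈ Icc 0 P.T, ∀ x u, du v.γ t x u = 0 := fun t ht x u => by
    rw [du, funext fun w => hγ t ht x w, deriv_const]
  have affine : ∀ a c u : ℝ, HasDerivAt (fun w => a * w + c) a u := fun a c u => by
    simpa using ((hasDerivAt_id u).const_mul a).add_const c
  have hφt : ∀ t ∈ Icc 0 P.T, ∀ x u,
      dt P.T v.φ t x u = dt2 P.T δ t x * u + dt2 P.T β t x := fun t ht x u =>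
    (derivWithin_congr (fun s hs => hφ s hs x u) (hφ t ht x u)).trans
      ((((hδ.differentiableWithinAt_t ht x).hasDerivWithinAt.mul_const u).add
        (hβ.differentiableWithinAt_t ht x).hasDerivWithinAt).derivWithin
          (P.uniqueDiffWithinAt ht))
  have hφx : ∀ t ∈ Icc 0 P.T, ∀ x u, dx v.φ t x u = dx2 δ t x * u + dx2 β t x :=
    fun t ht x u => by
      rw [dx, funext fun y => hφ t ht y u]
      exact (((hδ.differentiable_x ht x).hasDerivAt.mul_const u).add
        (hβ.differentiable_x ht x).hasDerivAt).deriv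
  have hφxx : ∀ t ∈ Icc 0 P.T, ∀ x u,
      dx (dx v.φ) t x u = dx2 (dx2 δ) t x * u + dx2 (dx2 β) t x := fun t ht x u => by
    rw [dx, funext fun y => hφx t ht y u]
    exact (((hδ.differentiable_dx2 ht x).hasDerivAt.mul_const u).add
      (hβ.differentiable_dx2 ht x).hasDerivAt).deriv
  have hφu : ∀ t ∈ Icc 0 P.T, ∀ x u, du v.φ t x u = δ t x := fun t ht x u => by
    rw [du, funext fun w => hφ t ht x w, (affine _ _ u).deriv]
  have hφxu : ∀ t ∈ Icc 0 P.T, ∀ x u, du (dx v.φ) t x u = dx2 δ t x := fun t ht x u => by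
    rw [du, funext fun w => hφx t ht x w, (affine _ _ u).deriv]
  have hφuu : ∀ t ∈ Icc 0 P.T, ∀ x u, du (du v.φ) t x u = 0 := fun t ht x u => by
    rw [du, funext fun w => hφu t ht x w, deriv_const]
  constructor
  · intro h
    refine ⟨fun t ht x u p z hz => ?_, fun t ht x u p z hz => ?_, fun t ht x => ?_,
      fun t ht x => ?_⟩
    · have := h.eq1 t ht x u p z hz
      rw [hφt t ht, hφxx t ht, hφx t ht, hgθ t ht, hγ t ht, hφ t ht, hφu t ht] at this
      linear_combination this
    · have := h.eq2 t ht x u p z hz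
      rw [hγt t ht, hγxx t ht, hγx t ht, hγ t ht, hθ t ht, hbθ t ht, hφu t ht,
        hφxu t ht] at this
      linear_combination this
    · have := h.eqσ t ht x 0
      rwa [hγx t ht, hγ t ht, hθt t ht, hθ t ht] at this
    · have := h.terminal t ht x
      rw [hφ t ht, hγ t ht] at this
      linear_combination this
  · intro h
    refine ⟨⟨hθx, hθu, hγu, fun t ht x u => ?_⟩, fun t ht x u p z hz => ?_,
      fun t ht x u p z hz => ?_, hφuu, fun t ht x => ?_⟩
    · rw [hγx t ht, hγ t ht, hθt t ht, hθ t ht]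
      exact h.eqσ t ht x
    · rw [hφt t ht, hφxx t ht, hφx t ht, hgθ t ht, hγ t ht, hφ t ht, hφu t ht]
      linear_combination h.eq1 t ht x u p z hz
    · rw [hγt t ht, hγxx t ht, hγx t ht, hγ t ht, hθ t ht, hbθ t ht, hφu t ht, hφxu t ht]
      linear_combination h.eq2 t ht x u p z hz
    · rw [hφ t ht, hγ t ht]
      linear_combination h.β_eq t ht x

/-- All witnesses are built from slices of the components of `v`, hence are smooth: `θ(t, 0, 0)`,
`γ(t, x, 0)`, `β = φ(t, x, 0)` and `δ = φ(t, x, 1) - φ(t, x, 0)`. -/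
theorem reducedSystem_iff_exists_finalSystem : P.ReducedSystem v ↔
    ∃ (θ₀ : ℝ → ℝ) (γ₀ δ β : ℝ → ℝ → ℝ),
      ContDiffOn ℝ ((⊤ : ℕ∞) : WithTop ℕ∞) θ₀ (Icc 0 P.T) ∧
      Smooth2 P.T γ₀ ∧ Smooth2 P.T δ ∧ Smooth2 P.T β ∧ P.HasForm v θ₀ γ₀ δ ∧
      (∀ t ∈ Icc 0 P.T, ∀ x u, v.φ t x u = δ t x * u + β t x) ∧
      P.FinalSystem θ₀ γ₀ δ β := by
  constructor
  · intro h
    have hδ : Smooth2 P.T (fun t x => v.φ t x 1 - v.φ t x 0) :=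
      ContDiffOn.sub (v.smooth_φ.slice_u 1) (v.smooth_φ.slice_u 0)
    have hθ : ∀ t ∈ Icc 0 P.T, ∀ x u, v.θ t x u = v.θ t 0 0 := fun t ht x u =>
      (v.smooth_θ.eq_of_du_eq_zero ht (h.θ_u t ht x) u).trans
        (v.smooth_θ.eq_of_dx_eq_zero ht (fun y => h.θ_x t ht y 0) x)
    have hγ : ∀ t ∈ Icc 0 P.T, ∀ x u, v.γ t x u = v.γ t x 0 := fun t ht x u =>
      v.smooth_γ.eq_of_du_eq_zero ht (h.γ_u t ht x) u
    have hφ : ∀ t ∈ Icc 0 P.T, ∀ x u,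
        v.φ t x u = (v.φ t x 1 - v.φ t x 0) * u + v.φ t x 0 := fun t ht x u =>
      v.smooth_φ.eq_affine_of_du_du_eq_zero ht (h.φ_uu t ht x) u
    have hF := (reducedSystem_iff_finalSystem (θ₀ := fun t => v.θ t 0 0)
      (γ₀ := fun t x => v.γ t x 0) hδ (v.smooth_φ.slice_u 0) hθ hγ hφ).1 h
    exact ⟨_, _, _, _, (v.smooth_θ.slice_u 0).contDiffOn_t 0, v.smooth_γ.slice_u 0, hδ,
      -- The formula for `β` in the final system rewrites `δ u + β` as the form of `φ` that
      -- `HasForm` asks for.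
      v.smooth_φ.slice_u 0, ⟨hθ, hγ, fun t ht x u => by
        linear_combination hφ t ht x u + hF.β_eq t ht x⟩, hφ, hF⟩
  · rintro ⟨θ₀, γ₀, δ, β, -, -, hδ, hβ, hform, hφ, hF⟩
    exact (reducedSystem_iff_finalSystem hδ hβ hform.θ_eq hform.γ_eq hφ).2 hF

end Problem

end SemilinearPDE

theorem mainTheorem4 (P : SemilinearPDE.Problem)
    (hσ : ∀ t ∈ Set.Icc 0 P.T, ∀ x, P.σ t x ≠ 0) (v : SemilinearPDE.VField P.T) :
    -- the determining system is equivalent to the simplified one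
    (P.DeterminingSystem v ↔ P.ReducedSystem v) ∧
    -- and to the final structure, which gives the form of the vector field
    (P.DeterminingSystem v ↔
      ∃ (θ₀ : ℝ → ℝ) (γ₀ δ β : ℝ → ℝ → ℝ),
        ContDiffOn ℝ ((⊤ : ℕ∞) : WithTop ℕ∞) θ₀ (Set.Icc 0 P.T) ∧
        SemilinearPDE.Smooth2 P.T γ₀ ∧ SemilinearPDE.Smooth2 P.T δ ∧
        SemilinearPDE.Smooth2 P.T β ∧
        P.HasForm v θ₀ γ₀ δ ∧
        (∀ t ∈ Set.Icc 0 P.T, ∀ x u, v.φ t x u = δ t x * u + β t x) ∧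
        P.FinalSystem θ₀ γ₀ δ β) ∧
    -- solutions of the determining system are symmetry generators
    (P.DeterminingSystem v → P.IsLieSymmetry v) ∧
    -- every symmetry generator is projectable and satisfies the `σ`-equation
    (P.IsLieSymmetry v → P.ProjectableEquations v) ∧
    -- the converse of the third claim, for `g` independent of `z`
    ((∀ t ∈ Set.Icc 0 P.T, ∀ x y z z', P.g t x y z = P.g t x y z') →
      P.IsLieSymmetry v → P.DeterminingSystem v) := by
  have hiff := SemilinearPDE.Problem.determiningSystem_iff_reducedSystem (v := v) hσ
  exact ⟨hiff, hiff.trans SemilinearPDE.Problem.reducedSystem_iff_exists_finalSystem,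
    fun h => (hiff.1 h).isLieSymmetry, fun h => h.projectableEquations hσ,
    fun hg h => hiff.2 (h.reducedSystem hσ hg)⟩
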